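/- Let $r\ge 0$ be an integer. A \emph{finite graph} $G=(G_0,\widetilde G_1)$ consists of a finite set $G_0$ of vertices, a finite set $G_1$ of edges, a two-fold covering $\widetilde G_1\to G_1$ (the half-edges) with sheet-switching involution $\tau$, and an incidence map $\partial:\widetilde G_1\to G_0$ (loops and multiple edges are allowed). Extend $\tau$ and $\partial$ to $G_0\amalg\widetilde G_1$ by the identity on $G_0$. A \emph{graph monomorphism} $G\to G'$ is an injective map $f:G_0\amalg\widetilde G_1\to G'_0\amalg\widetilde G'_1$ which commutes with $\tau$ and $\partial$ and satisfies $f(G_0)=G'_0$ and $f(\widetilde G_1)\subseteq\widetilde G'_1$. Let $m\mathcal G(r)$ be the category of connected finite graphs with $r+1$ vertices and graph monomorphisms, and let $\mathcal S(r+1)$ be the category of sets with $r+1$ elements and bijections. For a category $\mathcal C$ let $B\mathcal C$ be its classifying space, the geometric realization of its nerve, and for a group $\Gamma$ let $B\Gamma$ be the classifying space of the category with one object and morphism group $\Gamma$. Let $V:m\mathcal G(r)\to\mathcal S(r+1)$ be the vertex functor $G\mapsto G_0$, and let $K:\mathcal S(r+1)\to m\mathcal G(r)$ be the functor which sends a set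 $S$ to the complete graph on $S$, whose edges are the two-element subsets of $S$ and whose half-edges are the ordered pairs of distinct elements of $S$. \textbf{Theorem.} The map $BV:Bm\mathcal G(r)\to B\mathcal S(r+1)$ is a homotopy equivalence with homotopy inverse $BK$. Moreover, the inclusion of the symmetric group $S_{r+1}$ in $\mathcal S(r+1)$ as the automorphism group of a standard set with $r+1$ elements induces a homotopy equivalence $BS_{r+1}\simeq B\mathcal S(r+1)$. Hence $$Bm\mathcal G(r)\simeq B\mathcal S(r+1)\simeq BS_{r+1}.$$ -/

import Mathlib

open CategoryTheory ContinuousMap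

universe u

/-- A finite graph (loops and multiple edges allowed): a finite set `V` of vertices, a finite set
`E` of edges, a two-fold covering `edge : H → E` of half-edges, and an incidence map `bd : H → V`.
The switch `tau` of the two sheets is determined by the covering: by the fields below the fibre of
`edge` containing `h` consists exactly of the two distinct elements `h` and `tau h`. -/
structure HalfEdgeGraph : Type (u + 1) where
  V : Type u
  E : Type u
  H : Type u
  [finiteV : Finite V]
  [finiteE : Finite E]
  edge : H → E
  edge_surjective : Function.Surjective edge
  tau : H → H
  edge_tau : ∀ h, edge (tau h) = edge h
  tau_ne : ∀ h, tau h ≠ h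
  eq_or_eq_tau : ∀ h k, edge k = edge h → k = h ∨ k = tau h
  bd : H → V

namespace HalfEdgeGraph

/-- The involution `τ` extended to `V ∐ H` by the identity on vertices. -/
def tauAll (G : HalfEdgeGraph.{u}) : G.V ⊕ G.H → G.V ⊕ G.H :=
  Sum.elim Sum.inl (fun h => Sum.inr (G.tau h))

/-- The incidence map `∂` extended to `V ∐ H` by the identity on vertices. -/
def bdAll (G : HalfEdgeGraph.{u}) : G.V ⊕ G.H → G.V ⊕ G.H :=
  Sum.elim Sum.inl (fun h => Sum.inl (G.bd h))

/-- A graph monomorphism `G → G'`: an injective map `V ∐ H → V' ∐ H'` commuting with `τ` and `∂`,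
mapping the vertices onto the vertices and half-edges to half-edges. -/
@[ext]
structure Mono (G G' : HalfEdgeGraph.{u}) : Type u where
  toFun : G.V ⊕ G.H → G'.V ⊕ G'.H
  map_tau : ∀ x, toFun (G.tauAll x) = G'.tauAll (toFun x)
  map_bd : ∀ x, toFun (G.bdAll x) = G'.bdAll (toFun x)
  injective : Function.Injective toFun
  image_vertices : toFun '' Set.range Sum.inl = Set.range Sum.inl
  image_halfEdges : toFun '' Set.range Sum.inr ⊆ Set.range Sum.inr

namespace Mono

/-- The identity monomorphism. -/
def id (G : HalfEdgeGraph.{u}) : Mono G G where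
  toFun := _root_.id
  map_tau _ := rfl
  map_bd _ := rfl
  injective := Function.injective_id
  image_vertices := Set.image_id _
  image_halfEdges := (Set.image_id _).subset

/-- Composition of monomorphisms. -/
def comp {G G' G'' : HalfEdgeGraph.{u}} (f : Mono G G') (g : Mono G' G'') : Mono G G'' where
  toFun := g.toFun ∘ f.toFun
  map_tau x := by simp [f.map_tau, g.map_tau]
  map_bd x := by simp [f.map_bd, g.map_bd]
  injective := g.injective.comp f.injective
  image_vertices := by rw [Set.image_comp, f.image_vertices, g.image_vertices]
  image_halfEdges := by
    rw [Set.image_comp]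
    exact (Set.image_mono f.image_halfEdges).trans g.image_halfEdges

/-- The map on vertices underlying a monomorphism (see `toFun_inl`). -/
def vertexMap {G G' : HalfEdgeGraph.{u}} (f : Mono G G') (v : G.V) : G'.V :=
  Sum.elim _root_.id G'.bd (f.toFun (Sum.inl v))

theorem toFun_inl {G G' : HalfEdgeGraph.{u}} (f : Mono G G') (v : G.V) :
    f.toFun (Sum.inl v) = Sum.inl (f.vertexMap v) := by
  have h : f.toFun (Sum.inl v) ∈ Set.range (Sum.inl : G'.V → G'.V ⊕ G'.H) := by
    rw [← f.image_vertices]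
    exact ⟨_, ⟨v, rfl⟩, rfl⟩
  obtain ⟨w, hw⟩ := h
  simp [vertexMap, ← hw]

theorem vertexMap_bijective {G G' : HalfEdgeGraph.{u}} (f : Mono G G') :
    Function.Bijective f.vertexMap := by
  constructor
  · intro v w h
    have : f.toFun (Sum.inl v) = f.toFun (Sum.inl w) := by rw [toFun_inl, toFun_inl, h]
    exact Sum.inl_injective (f.injective this)
  · intro w
    have h : (Sum.inl w : G'.V ⊕ G'.H) ∈ f.toFun '' Set.range Sum.inl := by
      rw [f.image_vertices]
      exact ⟨w, rfl⟩
    obtain ⟨_, ⟨v, rfl⟩, hv⟩ := h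
    rw [toFun_inl] at hv
    exact ⟨v, Sum.inl_injective hv⟩

theorem comp_vertexMap {G G' G'' : HalfEdgeGraph.{u}} (f : Mono G G') (g : Mono G' G'') (v : G.V) :
    (f.comp g).vertexMap v = g.vertexMap (f.vertexMap v) := by
  have h : (f.comp g).toFun (Sum.inl v) = g.toFun (f.toFun (Sum.inl v)) := rfl
  rw [toFun_inl, toFun_inl, toFun_inl] at h
  exact Sum.inl_injective h

end Mono

/-- A graph is connected if it has a vertex and any two vertices are joined by an edge path. -/
def Connected (G : HalfEdgeGraph.{u}) : Prop :=
  Nonempty G.V ∧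
    ∀ v w : G.V, Relation.ReflTransGen (fun a b => ∃ h : G.H, G.bd h = a ∧ G.bd (G.tau h) = b) v w

/-- The complete graph on a finite set `S`: edges are the two-element subsets of `S` (encoded as
non-diagonal unordered pairs), half-edges are the ordered pairs of distinct elements. -/
def complete (S : Type u) [Finite S] : HalfEdgeGraph.{u} where
  V := S
  E := {e : Sym2 S // ¬ e.IsDiag}
  H := {p : S × S // p.1 ≠ p.2}
  edge p := ⟨s(p.1.1, p.1.2), fun h => p.2 (Sym2.mk_isDiag_iff.1 h)⟩
  edge_surjective := by
    rintro ⟨e, he⟩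
    induction e using Sym2.ind with
    | _ a b => exact ⟨⟨(a, b), fun h => he (Sym2.mk_isDiag_iff.2 h)⟩, rfl⟩
  tau p := ⟨(p.1.2, p.1.1), p.2.symm⟩
  edge_tau p := Subtype.ext Sym2.eq_swap
  tau_ne p h := p.2 (congrArg (fun q => q.1.2) h)
  eq_or_eq_tau := by
    rintro ⟨⟨a, b⟩, h⟩ ⟨⟨c, d⟩, k⟩ e
    simpa using e
  bd p := p.1.1

theorem complete_connected (S : Type u) [Finite S] [Nonempty S] : (complete S).Connected := by
  refine ⟨‹Nonempty S›, fun v w => ?_⟩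
  by_cases h : v = w
  · subst h
    exact Relation.ReflTransGen.refl
  · exact Relation.ReflTransGen.single ⟨⟨(v, w), h⟩, rfl, rfl⟩

/-- The isomorphism of complete graphs induced by a bijection. -/
def completeMap {S T : Type u} [Finite S] [Finite T] (e : S ≃ T) :
    Mono (complete S) (complete T) where
  toFun := Sum.map e (fun p => ⟨(e p.1.1, e p.1.2), fun h => p.2 (e.injective h)⟩)
  map_tau := by rintro (v | h) <;> rfl
  map_bd := by rintro (v | h) <;> rfl
  injective := by
    refine Sum.map_injective.2 ⟨e.injective, ?_⟩
    rintro ⟨⟨a, b⟩, h⟩ ⟨⟨c, d⟩, k⟩ hk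
    have hk' := congrArg Subtype.val hk
    simp only [Prod.mk.injEq, EmbeddingLike.apply_eq_iff_eq] at hk'
    exact Subtype.ext (Prod.ext hk'.1 hk'.2)
  image_vertices := by
    ext x
    constructor
    · rintro ⟨_, ⟨v, rfl⟩, rfl⟩
      exact ⟨e v, rfl⟩
    · rintro ⟨w, rfl⟩
      exact ⟨_, ⟨e.symm w, rfl⟩, congrArg Sum.inl (e.apply_symm_apply w)⟩
  image_halfEdges := by
    rintro _ ⟨_, ⟨h, rfl⟩, rfl⟩
    exact ⟨_, rfl⟩

end HalfEdgeGraph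

/-- Objects of `m𝒢(r)`: connected graphs with `r + 1` vertices. -/
structure MGraph (r : ℕ) : Type (u + 1) where
  graph : HalfEdgeGraph.{u}
  connected : graph.Connected
  card_vertices : Nat.card graph.V = r + 1

/-- The category `m𝒢(r)` of connected graphs with `r + 1` vertices and graph monomorphisms. -/
instance MGraph.category (r : ℕ) : Category.{u} (MGraph.{u} r) where
  Hom G G' := HalfEdgeGraph.Mono G.graph G'.graph
  id G := HalfEdgeGraph.Mono.id G.graph
  comp f g := f.comp g

/-- Objects of `𝒮(n)`: finite sets with `n` elements. -/
structure SetOfCard (n : ℕ) : Type (u + 1) where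
  carrier : Type u
  [finite : Finite carrier]
  card_eq : Nat.card carrier = n

attribute [instance] HalfEdgeGraph.finiteV HalfEdgeGraph.finiteE SetOfCard.finite

/-- The category `𝒮(n)` of sets with `n` elements and bijections. -/
instance SetOfCard.category (n : ℕ) : Category.{u} (SetOfCard.{u} n) where
  Hom S T := S.carrier ≃ T.carrier
  id S := Equiv.refl S.carrier
  comp e f := e.trans f

/-- The vertex functor `V : m𝒢(r) ⥤ 𝒮(r + 1)`. -/
noncomputable def vertexFunctor (r : ℕ) : MGraph.{u} r ⥤ SetOfCard.{u} (r + 1) where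
  obj G := { carrier := G.graph.V, card_eq := G.card_vertices }
  map f := Equiv.ofBijective f.vertexMap f.vertexMap_bijective
  map_id _ := Equiv.ext fun _ => rfl
  map_comp f g := Equiv.ext fun v => HalfEdgeGraph.Mono.comp_vertexMap f g v

/-- The complete graph functor `K : 𝒮(r + 1) ⥤ m𝒢(r)`. -/
def completeGraphFunctor (r : ℕ) : SetOfCard.{u} (r + 1) ⥤ MGraph.{u} r where
  obj S :=
    { graph := HalfEdgeGraph.complete S.carrier
      connected :=
        have : Nonempty S.carrier := (Nat.card_pos_iff.1 (by rw [S.card_eq]; omega)).1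
        HalfEdgeGraph.complete_connected S.carrier
      card_vertices := S.card_eq }
  map e := HalfEdgeGraph.completeMap e
  map_id S := HalfEdgeGraph.Mono.ext (by funext x; rcases x with v | h <;> rfl)
  map_comp e f := HalfEdgeGraph.Mono.ext (by funext x; rcases x with v | h <;> rfl)

/-- The symmetric group `S_n`, placed in the universe `u`. -/
abbrev SymGroup (n : ℕ) : Type u := ULift.{u} (Equiv.Perm (Fin n))

/-- The one-object category of a group, with its type of objects placed in the universe `u + 1`. -/
def OneObjectCategory (G : Type u) : Type (u + 1) := ULift.{u + 1} (SingleObj G)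

instance OneObjectCategory.category (G : Type u) [Group G] :
    Category.{u} (OneObjectCategory.{u} G) :=
  uliftCategory (SingleObj G)

/-- The inclusion of `S_n` in `𝒮(n)` as the group of automorphisms of the set `{0, …, n - 1}`. -/
def symInclusion (n : ℕ) : OneObjectCategory.{u} (SymGroup.{u} n) ⥤ SetOfCard.{u} n where
  obj _ := { carrier := ULift.{u} (Fin n), card_eq := by simp }
  map σ := Equiv.ulift.symm.permCongr (ULift.down σ)
  map_id _ := Equiv.ext fun _ => rfl
  map_comp _ _ := Equiv.ext fun _ => rfl

/-- The classifying space `BC` of a category: the geometric realization of its nerve. -/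
noncomputable abbrev classifyingSpace (C : Type (u + 1)) [Category.{u} C] : TopCat.{u + 1} :=
  SSet.toTop.obj (nerve C)

/-- The continuous map `BC → BD` induced by a functor. -/
noncomputable def classifyingMap {C D : Type (u + 1)} [Category.{u} C] [Category.{u} D]
    (F : C ⥤ D) : C(classifyingSpace C, classifyingSpace D) :=
  (SSet.toTop.map (nerveMap F)).hom

/-- The monotone map `Fin (n + 2) → Fin 2` which is `0` exactly on the first `k + 1` elements. -/
def stepMap {n : ℕ} (k : Fin (n + 1)) (i : Fin (n + 2)) : Fin 2 :=
  if i ≤ k.castSucc then 0 else 1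

theorem stepMap_monotone {n : ℕ} (k : Fin (n + 1)) : Monotone (stepMap k) := by
  intro i j h
  unfold stepMap
  split_ifs with h₁ h₂
  · exact le_rfl
  · exact Fin.zero_le _
  · exact absurd (h.trans ‹_›) h₁
  · exact le_rfl

theorem stepMap_succAbove_succ {n : ℕ} (k j : Fin (n + 1)) :
    stepMap k (k.succ.succAbove j) = if k < j then 1 else 0 := by
  rcases lt_or_ge k j with h | h
  · rw [if_pos h, Fin.succAbove_of_lt_succ _ _ (Fin.succ_lt_succ_iff.2 h)]
    exact if_neg (not_le.2 (Fin.castSucc_lt_succ_iff.2 h.le))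
  · rw [if_neg (not_lt.2 h), Fin.succAbove_of_castSucc_lt _ _ (Fin.castSucc_lt_succ_iff.2 h)]
    exact if_pos (Fin.castSucc_le_castSucc_iff.2 h)

theorem stepMap_succAbove_castSucc {n : ℕ} (k j : Fin (n + 1)) :
    stepMap k (k.castSucc.succAbove j) = if k ≤ j then 1 else 0 := by
  rcases lt_or_ge j k with h | h
  · rw [if_neg (not_le.2 h), Fin.succAbove_of_castSucc_lt _ _ (Fin.castSucc_lt_castSucc_iff.2 h)]
    exact if_pos (Fin.castSucc_le_castSucc_iff.2 h.le)
  · rw [if_pos h, Fin.succAbove_of_le_castSucc _ _ (Fin.castSucc_le_castSucc_iff.2 h)]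
    exact if_neg (not_le.2 (Fin.castSucc_lt_succ_iff.2 h))

theorem stepMap_succAbove {n : ℕ} (k : Fin n) (j : Fin (n + 1)) :
    stepMap k.castSucc (k.castSucc.succ.succAbove j) =
      stepMap k.succ (k.castSucc.succ.succAbove j) := by
  rw [stepMap_succAbove_succ, Fin.succ_castSucc, stepMap_succAbove_castSucc]
  rfl

namespace stdSimplex

theorem map_apply {X Y : Type*} [Fintype X] [Fintype Y] [DecidableEq Y] (f : X → Y)
    (s : stdSimplex ℝ X) (y : Y) : map f s y = ∑ x with f x = y, s x := by
  simp [map_coe, FunOnFinite.linearMap_apply_apply]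

theorem ext_fin_two {s t : stdSimplex ℝ (Fin 2)} (h : s 1 = t 1) : s = t := by
  ext i
  have hs := add_eq_one s
  have ht := add_eq_one t
  fin_cases i
  · simp only [Fin.zero_eta]; linarith
  · exact h

theorem exists_map_succAbove {n : ℕ} (u : stdSimplex ℝ (Fin (n + 2))) (i : Fin (n + 2))
    (h : u i = 0) : ∃ t : stdSimplex ℝ (Fin (n + 1)), map i.succAbove t = u := by
  refine ⟨⟨fun j => u (i.succAbove j), fun j => zero_le u _, ?_⟩, ?_⟩
  · have := sum_eq_one u
    rwa [Fin.sum_univ_succAbove _ i, h, zero_add] at this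
  · ext j
    rw [map_apply, Finset.sum_filter]
    rcases Fin.eq_self_or_eq_succAbove i j with rfl | ⟨j, rfl⟩
    · simp [h, Fin.succAbove_ne]
    · simp only [Fin.succAbove_right_inj, Finset.sum_ite_eq', Finset.mem_univ, if_true]
      rfl

/-- The prism decomposition of `Δ^n × Δ^1`: the affine inclusion of the `k`-th simplex. -/
noncomputable def prism {n : ℕ} (k : Fin (n + 1)) (u : stdSimplex ℝ (Fin (n + 2))) :
    stdSimplex ℝ (Fin (n + 1)) × stdSimplex ℝ (Fin 2) :=
  (map k.predAbove u, map (stepMap k) u)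

theorem continuous_prism {n : ℕ} (k : Fin (n + 1)) : Continuous (prism k) :=
  (continuous_map _).prodMk (continuous_map _)

theorem map_stepMap_apply_one {n : ℕ} (k : Fin (n + 1)) (u : stdSimplex ℝ (Fin (n + 2))) :
    map (stepMap k) u 1 = ∑ i with k.castSucc < i, u i := by
  rw [map_apply]
  congr 1
  ext i
  simp [stepMap]

theorem lt_predAbove_iff {n : ℕ} (k j : Fin (n + 1)) (i : Fin (n + 2)) (h : k ≤ j) :
    j < k.predAbove i ↔ j.succ < i := by
  rw [Fin.le_def] at h
  unfold Fin.predAbove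
  split_ifs with hi <;>
  · have hi' := hi
    simp only [Fin.lt_def, Fin.val_castSucc, Fin.val_pred, Fin.val_succ, Fin.coe_castPred] at hi' ⊢
    omega

theorem sum_map_predAbove {n : ℕ} (k j : Fin (n + 1)) (u : stdSimplex ℝ (Fin (n + 2))) :
    ∑ j' with j < j', map k.predAbove u j' = ∑ i with j < k.predAbove i, u i := by
  rw [← Finset.sum_fiberwise_of_maps_to (s := {i | j < k.predAbove i}) (t := {j' | j < j'})
    (g := k.predAbove) (fun i hi => by simpa using hi)]
  refine Finset.sum_congr rfl fun j' hj' => ?_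
  rw [map_apply, Finset.filter_filter]
  congr 1
  ext i
  simp only [Finset.mem_filter, Finset.mem_univ, true_and] at hj' ⊢
  exact ⟨fun h => ⟨h ▸ hj', h⟩, fun h => h.2⟩

theorem apply_succ_add_sum {n : ℕ} (k : Fin (n + 1)) (u : stdSimplex ℝ (Fin (n + 2))) :
    u k.succ + ∑ j with k < j, map k.predAbove u j = map (stepMap k) u 1 := by
  simp only [sum_map_predAbove, lt_predAbove_iff k k _ le_rfl]
  rw [map_stepMap_apply_one, ← Finset.sum_insert (by simp)]
  congr 1
  ext i
  simp only [Finset.mem_filter, Finset.mem_univ, true_and, Finset.mem_insert, Fin.lt_def,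
    Fin.ext_iff, Fin.val_castSucc, Fin.val_succ]
  omega

theorem eq_of_predAbove_eq {n : ℕ} (k : Fin (n + 1)) {i i' : Fin (n + 2)}
    (h₀ : i ≠ k.castSucc) (h₁ : i ≠ k.succ) (h : k.predAbove i' = k.predAbove i) : i' = i := by
  unfold Fin.predAbove at h
  split_ifs at h with h₂ h₃ h₃ <;>
  · have h₂' := h₂
    have h₃' := h₃
    simp only [Fin.lt_def, Fin.ext_iff, Fin.val_castSucc, Fin.val_pred, Fin.val_succ,
      Fin.coe_castPred, ne_eq] at h₀ h₁ h h₂' h₃' ⊢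
    omega

theorem prism_injective {n : ℕ} (k : Fin (n + 1)) : Function.Injective (prism k) := by
  intro u v h
  obtain ⟨h₁, h₂⟩ := Prod.ext_iff.1 h
  change map k.predAbove u = map k.predAbove v at h₁
  change map (stepMap k) u = map (stepMap k) v at h₂
  have aux : ∀ i, i ≠ k.castSucc → u i = v i := by
    intro i hi
    by_cases hi' : i = k.succ
    · have hu := apply_succ_add_sum k u
      have hv := apply_succ_add_sum k v
      rw [h₁, h₂, ← hv] at hu
      rw [hi']
      exact add_right_cancel hu
    · have key : ∀ w : stdSimplex ℝ (Fin (n + 2)), map k.predAbove w (k.predAbove i) = w i := by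
        intro w
        rw [map_apply, Finset.sum_eq_single_of_mem i (by simp)]
        intro i' hi'' hne
        exact absurd (eq_of_predAbove_eq k hi hi' (by simpa using hi'')) hne
      rw [← key u, ← key v, h₁]
  ext i
  by_cases hi : i = k.castSucc
  · have hu := sum_eq_one u
    rw [← sum_eq_one v, Fin.sum_univ_succAbove _ k.castSucc,
      Fin.sum_univ_succAbove _ k.castSucc,
      Finset.sum_congr rfl fun j _ => aux _ (Fin.succAbove_ne _ j)] at hu
    rw [hi]
    exact add_right_cancel hu
  · exact aux i hi

theorem eq_zero_of_prism_eq {n : ℕ} {k l : Fin (n + 1)} (hkl : k < l)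
    {u v : stdSimplex ℝ (Fin (n + 2))} (h : prism k u = prism l v) : u k.succ = 0 := by
  obtain ⟨h₁, h₂⟩ := Prod.ext_iff.1 h
  change map k.predAbove u = map l.predAbove v at h₁
  change map (stepMap k) u = map (stepMap l) v at h₂
  have h₃ := apply_succ_add_sum k u
  rw [h₂, h₁, sum_map_predAbove, map_stepMap_apply_one] at h₃
  have h₄ : ∑ i with l.castSucc < i, v i ≤ ∑ i with k < l.predAbove i, v i := by
    refine Finset.sum_le_sum_of_subset_of_nonneg ?_ fun i _ _ => zero_le v i
    intro i hi
    simp only [Finset.mem_filter, Finset.mem_univ, true_and] at hi ⊢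
    rw [Fin.predAbove_of_castSucc_lt _ _ hi]
    rw [Fin.lt_def] at hi hkl ⊢
    rw [Fin.val_castSucc] at hi
    rw [Fin.val_pred]
    omega
  have := zero_le u k.succ
  linarith

theorem map_predAbove_map_succAbove_succ {n : ℕ} (k : Fin (n + 1))
    (t : stdSimplex ℝ (Fin (n + 1))) : map k.predAbove (map k.succ.succAbove t) = t := by
  rw [map_comp_apply]
  convert map_id_apply t
  ext j : 1
  change k.predAbove (k.succ.succAbove j) = j
  rcases lt_or_ge k j with h | h
  · rw [Fin.succAbove_of_lt_succ _ _ (Fin.succ_lt_succ_iff.2 h),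
      Fin.predAbove_of_castSucc_lt _ _ (Fin.castSucc_lt_succ_iff.2 h.le), Fin.pred_succ]
  · rw [Fin.succAbove_of_castSucc_lt _ _ (Fin.castSucc_lt_succ_iff.2 h),
      Fin.predAbove_of_le_castSucc _ _ (Fin.castSucc_le_castSucc_iff.2 h), Fin.castPred_castSucc]

theorem map_predAbove_map_succAbove_castSucc {n : ℕ} (k : Fin (n + 1))
    (t : stdSimplex ℝ (Fin (n + 1))) : map k.predAbove (map k.castSucc.succAbove t) = t := by
  rw [map_comp_apply]
  convert map_id_apply t
  ext j : 1
  exact Fin.predAbove_succAbove k j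

theorem map_stepMap_map_succAbove_succ {n : ℕ} (k : Fin (n + 1))
    (t : stdSimplex ℝ (Fin (n + 1))) :
    map (stepMap k) (map k.succ.succAbove t) 1 = ∑ j with k < j, t j := by
  rw [map_comp_apply, map_apply]
  congr 1
  ext j
  simp [stepMap_succAbove_succ]

theorem map_stepMap_map_succAbove_castSucc {n : ℕ} (k : Fin (n + 1))
    (t : stdSimplex ℝ (Fin (n + 1))) :
    map (stepMap k) (map k.castSucc.succAbove t) 1 = ∑ j with k ≤ j, t j := by
  rw [map_comp_apply, map_apply]
  congr 1
  ext j
  simp [stepMap_succAbove_castSucc]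

theorem exists_prism_eq_of_mem_Icc {n : ℕ} (k : Fin (n + 1)) (t : stdSimplex ℝ (Fin (n + 1)))
    (s : stdSimplex ℝ (Fin 2)) (h₁ : ∑ j with k < j, t j ≤ s 1) (h₂ : s 1 ≤ ∑ j with k ≤ j, t j) :
    ∃ u, prism k u = (t, s) := by
  set w₀ := map k.succ.succAbove t with hw₀
  set w₁ := map k.castSucc.succAbove t with hw₁
  have hs : s 1 ∈ segment ℝ (∑ j with k < j, t j) (∑ j with k ≤ j, t j) := by
    rw [segment_eq_Icc (h₁.trans h₂)]
    exact ⟨h₁, h₂⟩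
  obtain ⟨a, b, ha, hb, hab, hs⟩ := hs
  refine ⟨⟨a • ⇑w₀ + b • ⇑w₁, convex_stdSimplex ℝ _ w₀.2 w₁.2 ha hb hab⟩, Prod.ext ?_ ?_⟩
  · refine ext ?_
    change FunOnFinite.linearMap ℝ ℝ k.predAbove (a • ⇑w₀ + b • ⇑w₁) = t
    rw [map_add, map_smul, map_smul, ← map_coe, ← map_coe, hw₀, hw₁,
      map_predAbove_map_succAbove_succ, map_predAbove_map_succAbove_castSucc, ← add_smul, hab,
      one_smul]
  · refine ext_fin_two ?_
    change FunOnFinite.linearMap ℝ ℝ (stepMap k) (a • ⇑w₀ + b • ⇑w₁) 1 = s 1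
    rw [map_add, map_smul, map_smul, ← map_coe, ← map_coe, hw₀, hw₁, Pi.add_apply, Pi.smul_apply,
      Pi.smul_apply, map_stepMap_map_succAbove_succ, map_stepMap_map_succAbove_castSucc, hs]

theorem exists_prism_eq {n : ℕ} (p : stdSimplex ℝ (Fin (n + 1)) × stdSimplex ℝ (Fin 2)) :
    ∃ k u, prism k u = p := by
  obtain ⟨t, s⟩ := p
  suffices ∀ m (hm : m < n + 1), s 1 ≤ ∑ j with (⟨m, hm⟩ : Fin (n + 1)) ≤ j, t j →
      ∃ k u, prism k u = (t, s) by
    refine this 0 (Nat.succ_pos _) ?_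
    rw [Finset.filter_true_of_mem (by simp), sum_eq_one]
    exact le_one s 1
  intro m hm
  induction hd : n - m generalizing m with
  | zero =>
    intro h
    refine ⟨_, exists_prism_eq_of_mem_Icc ⟨m, hm⟩ t s ?_ h⟩
    rw [Finset.filter_false_of_mem, Finset.sum_empty]
    · exact zero_le s 1
    · intro j _
      rw [Fin.lt_def]
      dsimp only
      omega
  | succ d ih =>
    intro h
    rcases le_total (∑ j with (⟨m, hm⟩ : Fin (n + 1)) < j, t j) (s 1) with h' | h'
    · exact ⟨_, exists_prism_eq_of_mem_Icc ⟨m, hm⟩ t s h' h⟩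
    · refine ih (m + 1) (by omega) (by omega) (h'.trans_eq ?_)
      congr 1

end stdSimplex

open Simplicial Opposite

namespace GeometricRealization

/-- The characteristic map `Δ^n → |X|` of an `n`-simplex of `X`. -/
noncomputable def charMap {X : SSet.{u}} {n : SimplexCategory} (x : X.obj (op n)) :
    C(stdSimplex ℝ (Fin (n.len + 1)), SSet.toTop.obj X) :=
  TopCat.toSSetObjEquiv _ _ ((sSetTopAdj.unit.app X).app (op n) x)

theorem toSSetObjEquiv_naturality {Z : TopCat.{u}} {m n : SimplexCategory} (f : m ⟶ n)
    (z : (TopCat.toSSet.obj Z).obj (op n)) (t : stdSimplex ℝ (Fin (m.len + 1))) :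
    TopCat.toSSetObjEquiv Z (op m) ((TopCat.toSSet.obj Z).map f.op z) t =
      TopCat.toSSetObjEquiv Z (op n) z (stdSimplex.map f t) :=
  rfl

theorem toSSetObjEquiv_map {Z W : TopCat.{u}} {n : SimplexCategory} (f : Z ⟶ W)
    (z : (TopCat.toSSet.obj Z).obj (op n)) (t : stdSimplex ℝ (Fin (n.len + 1))) :
    TopCat.toSSetObjEquiv W (op n) ((TopCat.toSSet.map f).app (op n) z) t =
      f (TopCat.toSSetObjEquiv Z (op n) z t) :=
  rfl

theorem charMap_map {X : SSet.{u}} {m n : SimplexCategory} (f : m ⟶ n) (x : X.obj (op n))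
    (t : stdSimplex ℝ (Fin (m.len + 1))) :
    charMap (X.map f.op x) t = charMap x (stdSimplex.map f t) := by
  unfold charMap
  rw [← toSSetObjEquiv_naturality]
  congr 2
  exact ConcreteCategory.congr_hom ((sSetTopAdj.unit.app X).naturality f.op) x

theorem toTop_map_charMap {X Y : SSet.{u}} (f : X ⟶ Y) {n : SimplexCategory} (x : X.obj (op n))
    (t : stdSimplex ℝ (Fin (n.len + 1))) :
    SSet.toTop.map f (charMap x t) = charMap (f.app (op n) x) t := by
  have h₀ : sSetTopAdj.unit.app X ≫ TopCat.toSSet.map (SSet.toTop.map f) =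
      f ≫ sSetTopAdj.unit.app Y := sSetTopAdj.unit_naturality f
  have h := ConcreteCategory.congr_hom (NatTrans.congr_app h₀ (op n)) x
  exact (toSSetObjEquiv_map _ _ _).symm.trans
    (congrArg (fun z => TopCat.toSSetObjEquiv _ (op n) z t) h)

theorem toTop_hom_ext {X : SSet.{u}} {Z : TopCat.{u}} {f g : SSet.toTop.obj X ⟶ Z}
    (h : ∀ (n : SimplexCategory) (x : X.obj (op n)) (t : stdSimplex ℝ (Fin (n.len + 1))),
      f (charMap x t) = g (charMap x t)) : f = g := by
  apply (sSetTopAdj.homEquiv X Z).injective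
  ext n x
  apply (TopCat.toSSetObjEquiv Z n).injective
  ext t
  rw [Adjunction.homEquiv_unit, Adjunction.homEquiv_unit]
  exact h n.unop x t

theorem exists_desc {X : SSet.{u}} {Z : TopCat.{u}}
    (φ : ∀ n : SimplexCategory, X.obj (op n) → C(stdSimplex ℝ (Fin (n.len + 1)), Z))
    (hφ : ∀ {m n : SimplexCategory} (f : m ⟶ n) (x : X.obj (op n)) t,
      φ m (X.map f.op x) t = φ n x (stdSimplex.map f t)) :
    ∃ g : SSet.toTop.obj X ⟶ Z, ∀ (n : SimplexCategory) (x : X.obj (op n)) t,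
      g (charMap x t) = φ n x t := by
  let ψ : X ⟶ TopCat.toSSet.obj Z :=
    { app n := ↾fun x => (TopCat.toSSetObjEquiv Z n).symm (φ n.unop x)
      naturality m n f := by
        ext x
        apply (TopCat.toSSetObjEquiv Z n).injective
        ext t
        exact hφ f.unop x t }
  refine ⟨(sSetTopAdj.homEquiv X Z).symm ψ, fun n x t => ?_⟩
  have h₀ : sSetTopAdj.unit.app X ≫ TopCat.toSSet.map ((sSetTopAdj.homEquiv X Z).symm ψ) = ψ :=
    (sSetTopAdj.homEquiv_unit _ _ _).symm.trans (Equiv.apply_symm_apply _ ψ)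
  have h := ConcreteCategory.congr_hom (NatTrans.congr_app h₀ (op n)) x
  exact (toSSetObjEquiv_map _ _ _).symm.trans
    (congrArg (fun z => TopCat.toSSetObjEquiv _ (op n) z t) h)

end GeometricRealization

namespace GeometricRealization

/-- `stepMap` as a morphism of the simplex category. -/
def stepHom {n : ℕ} (k : Fin (n + 1)) : ⦋n + 1⦌ ⟶ ⦋1⦌ :=
  SimplexCategory.Hom.mk ⟨stepMap k, stepMap_monotone k⟩

theorem exists_factorization {n : ℕ} {m : SimplexCategory} (α : m ⟶ ⦋n⦌) (β : m ⟶ ⦋1⦌) :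
    ∃ (k : Fin (n + 1)) (γ : m ⟶ ⦋n + 1⦌), γ ≫ SimplexCategory.σ k = α ∧ γ ≫ stepHom k = β := by
  obtain ⟨k, hk₀, hk₁⟩ : ∃ k : Fin (n + 1), (∀ i, β i = 0 → α i ≤ k) ∧ ∀ i, β i ≠ 0 → k ≤ α i := by
    by_cases h : ∃ i, β i = 0
    · obtain ⟨i, hi, hmax⟩ := (Finset.univ.filter fun i => β i = 0).exists_max_image id
        (by obtain ⟨i, hi⟩ := h; exact ⟨i, by simpa using hi⟩)
      simp only [Finset.mem_filter, Finset.mem_univ, true_and, id] at hi hmax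
      refine ⟨α i, fun j hj => α.toOrderHom.monotone (hmax j hj), fun j hj => ?_⟩
      refine α.toOrderHom.monotone (le_of_not_ge fun hji => hj ?_)
      have : β j ≤ β i := β.toOrderHom.monotone hji
      rw [hi] at this
      exact Fin.le_zero_iff.1 this
    · push Not at h
      exact ⟨0, fun i hi => absurd hi (h i), fun i _ => Fin.zero_le _⟩
  refine ⟨k, SimplexCategory.Hom.mk
    ⟨fun i => if β i = 0 then (α i).castSucc else (α i).succ, ?_⟩, ?_, ?_⟩
  · intro i j hij
    have hα : α i ≤ α j := α.toOrderHom.monotone hij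
    have hβ : β i ≤ β j := β.toOrderHom.monotone hij
    dsimp only
    split_ifs with h₁ h₂ h₂
    · exact Fin.castSucc_le_castSucc_iff.2 hα
    · exact (Fin.castSucc_lt_succ_iff.2 hα).le
    · rw [h₂] at hβ
      exact absurd (Fin.le_zero_iff.1 hβ) h₁
    · exact Fin.succ_le_succ_iff.2 hα
  · ext i : 3
    change k.predAbove (if β i = 0 then (α i).castSucc else (α i).succ) = α i
    split_ifs with h
    · rw [Fin.predAbove_of_le_castSucc _ _ (Fin.castSucc_le_castSucc_iff.2 (hk₀ i h)),
        Fin.castPred_castSucc]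
    · rw [Fin.predAbove_of_castSucc_lt _ _ (Fin.castSucc_lt_succ_iff.2 (hk₁ i h)), Fin.pred_succ]
  · ext i : 3
    change stepMap k (if β i = 0 then (α i).castSucc else (α i).succ) = β i
    split_ifs with h
    · rw [h]
      exact if_pos (Fin.castSucc_le_castSucc_iff.2 (hk₀ i h))
    · rw [Fin.eq_one_of_ne_zero _ h]
      exact if_neg (not_le.2 (Fin.castSucc_lt_succ_iff.2 (hk₁ i h)))

/-- A family of maps out of the simplices of `X × Δ^1`, compatible with the simplicial operators. -/
structure CylinderFamily (X : SSet.{u}) (Z : TopCat.{u}) where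
  toFun : ∀ n : SimplexCategory, X.obj (op n) → (n ⟶ ⦋1⦌) →
    C(stdSimplex ℝ (Fin (n.len + 1)), Z)
  naturality : ∀ {m n : SimplexCategory} (f : m ⟶ n) (x : X.obj (op n)) (β : n ⟶ ⦋1⦌)
    (t : stdSimplex ℝ (Fin (m.len + 1))),
    toFun m (X.map f.op x) (f ≫ β) t = toFun n x β (stdSimplex.map f t)

namespace CylinderFamily

variable {X : SSet.{u}} {Z : TopCat.{u}} (φ : CylinderFamily X Z)

/-- The restriction of the family to the `k`-th simplex of the prism over `x`. -/
def onPrism {n : ℕ} (x : X.obj (op ⦋n⦌)) (k : Fin (n + 1)) : C(stdSimplex ℝ (Fin (n + 2)), Z) :=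
  φ.toFun ⦋n + 1⦌ (X.map (SimplexCategory.σ k).op x) (stepHom k)

theorem onPrism_map_succAbove {n : ℕ} (x : X.obj (op ⦋n⦌)) (k : Fin (n + 1)) (i : Fin (n + 2))
    (h : SimplexCategory.δ i ≫ SimplexCategory.σ k = 𝟙 _) (t : stdSimplex ℝ (Fin (n + 1))) :
    φ.onPrism x k (stdSimplex.map i.succAbove t) =
      φ.toFun ⦋n⦌ x (SimplexCategory.δ i ≫ stepHom k) t := by
  refine (φ.naturality (SimplexCategory.δ i) _ _ _).symm.trans ?_
  congr 2
  rw [← ConcreteCategory.comp_apply, ← X.map_comp, ← op_comp, h]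
  simp

theorem onPrism_castSucc_eq_succ {n : ℕ} (x : X.obj (op ⦋n⦌)) (k : Fin n)
    (t : stdSimplex ℝ (Fin (n + 1))) :
    φ.onPrism x k.castSucc (stdSimplex.map k.castSucc.succ.succAbove t) =
      φ.onPrism x k.succ (stdSimplex.map k.castSucc.succ.succAbove t) := by
  rw [onPrism_map_succAbove _ _ _ _ (SimplexCategory.δ_comp_σ_succ),
    onPrism_map_succAbove _ _ _ _ (by rw [Fin.succ_castSucc]; exact SimplexCategory.δ_comp_σ_self)]
  congr 2
  ext i : 3
  exact stepMap_succAbove k i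

theorem onPrism_eq_of_lt {n : ℕ} (x : X.obj (op ⦋n⦌)) {k l : Fin (n + 1)} (hkl : k < l)
    {u v : stdSimplex ℝ (Fin (n + 2))} (h : stdSimplex.prism k u = stdSimplex.prism l v)
    (ih : ∀ (k' : Fin (n + 1)) u', k'.val = k.val + 1 →
      stdSimplex.prism k' u' = stdSimplex.prism l v → φ.onPrism x k' u' = φ.onPrism x l v) :
    φ.onPrism x k u = φ.onPrism x l v := by
  obtain ⟨k, rfl⟩ := Fin.exists_castSucc_eq.2 (hkl.trans_le (Fin.le_last l)).ne
  obtain ⟨t, rfl⟩ := stdSimplex.exists_map_succAbove u _ (stdSimplex.eq_zero_of_prism_eq hkl h)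
  rw [onPrism_castSucc_eq_succ]
  refine ih _ _ (by simp) (Eq.trans ?_ h)
  refine Prod.ext ?_ ?_
  · change stdSimplex.map _ _ = stdSimplex.map _ _
    rw [stdSimplex.map_predAbove_map_succAbove_succ, Fin.succ_castSucc,
      stdSimplex.map_predAbove_map_succAbove_castSucc]
  · change stdSimplex.map _ _ = stdSimplex.map _ _
    rw [stdSimplex.map_comp_apply, stdSimplex.map_comp_apply]
    congr 1
    ext i : 1
    exact (stepMap_succAbove k i).symm

theorem onPrism_eq {n : ℕ} (x : X.obj (op ⦋n⦌)) {k l : Fin (n + 1)}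
    {u v : stdSimplex ℝ (Fin (n + 2))} (h : stdSimplex.prism k u = stdSimplex.prism l v) :
    φ.onPrism x k u = φ.onPrism x l v := by
  wlog hkl : k ≤ l generalizing k l u v
  · exact (this h.symm (le_of_not_ge hkl)).symm
  induction hd : l.val - k.val generalizing k u with
  | zero =>
    obtain rfl : k = l := le_antisymm hkl (Fin.le_def.2 (by omega))
    rw [stdSimplex.prism_injective k h]
  | succ d ih =>
    have hlt : k < l := Fin.lt_def.2 (by omega)
    exact φ.onPrism_eq_of_lt x hlt h fun k' u' hk' h' =>
      ih h' (Fin.le_def.2 (by omega)) (by omega)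

theorem exists_glue {n : SimplexCategory} (x : X.obj (op n)) :
    ∃ G : C(stdSimplex ℝ (Fin (n.len + 1)) × stdSimplex ℝ (Fin 2), Z),
      ∀ (m : SimplexCategory) (α : m ⟶ n) (β : m ⟶ ⦋1⦌) (u : stdSimplex ℝ (Fin (m.len + 1))),
        G (stdSimplex.map α u, stdSimplex.map β u) = φ.toFun m (X.map α.op x) β u := by
  induction n with | _ n
  let q : (Σ _ : Fin (n + 1), stdSimplex ℝ (Fin (n + 2))) →
    stdSimplex ℝ (Fin (n + 1)) × stdSimplex ℝ (Fin 2) := fun p => stdSimplex.prism p.1 p.2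
  have hq : Continuous q := continuous_sigma fun k => stdSimplex.continuous_prism k
  have hq' : Topology.IsQuotientMap q := hq.isClosedMap.isQuotientMap hq fun p => by
    obtain ⟨k, u, h⟩ := stdSimplex.exists_prism_eq p
    exact ⟨⟨k, u⟩, h⟩
  let g : C((Σ _ : Fin (n + 1), stdSimplex ℝ (Fin (n + 2))), Z) :=
    ⟨fun p => φ.onPrism x p.1 p.2, continuous_sigma fun k => (φ.onPrism x k).continuous⟩
  have hg : Function.FactorsThrough g q := fun p p' h => φ.onPrism_eq x h
  let qc : Topology.IsQuotientMap (⟨q, hq⟩ : C(_, _)) := hq'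
  refine ⟨qc.lift g hg, fun m α β u => ?_⟩
  obtain ⟨k, γ, rfl, rfl⟩ := exists_factorization α β
  have h := ContinuousMap.congr_fun (qc.lift_comp g hg) ⟨k, stdSimplex.map γ u⟩
  refine Eq.trans ?_ (h.trans ?_)
  · change _ = qc.lift g hg (stdSimplex.map _ _, stdSimplex.map _ _)
    rw [stdSimplex.map_comp_apply, stdSimplex.map_comp_apply]
    rfl
  · refine (φ.naturality γ _ _ _).symm.trans ?_
    congr 2
    rw [← ConcreteCategory.comp_apply, ← X.map_comp, ← op_comp]

/-- The glued map `Δ^n × Δ^1 → Z`. -/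
noncomputable def glue {n : SimplexCategory} (x : X.obj (op n)) :
    C(stdSimplex ℝ (Fin (n.len + 1)) × stdSimplex ℝ (Fin 2), Z) :=
  (φ.exists_glue x).choose

theorem glue_map {m n : SimplexCategory} (x : X.obj (op n)) (α : m ⟶ n) (β : m ⟶ ⦋1⦌)
    (u : stdSimplex ℝ (Fin (m.len + 1))) :
    φ.glue x (stdSimplex.map α u, stdSimplex.map β u) = φ.toFun m (X.map α.op x) β u :=
  (φ.exists_glue x).choose_spec m α β u

theorem exists_map_eq {n : SimplexCategory}
    (p : stdSimplex ℝ (Fin (n.len + 1)) × stdSimplex ℝ (Fin 2)) :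
    ∃ (m : SimplexCategory) (α : m ⟶ n) (β : m ⟶ ⦋1⦌) (u : stdSimplex ℝ (Fin (m.len + 1))),
      (stdSimplex.map α u, stdSimplex.map β u) = p := by
  induction n with | _ n
  obtain ⟨k, u, h⟩ := stdSimplex.exists_prism_eq p
  exact ⟨⦋n + 1⦌, SimplexCategory.σ k, stepHom k, u, h⟩

theorem glue_naturality {m n : SimplexCategory} (f : m ⟶ n) (x : X.obj (op n))
    (t : stdSimplex ℝ (Fin (m.len + 1))) (s : stdSimplex ℝ (Fin 2)) :
    φ.glue (X.map f.op x) (t, s) = φ.glue x (stdSimplex.map f t, s) := by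
  obtain ⟨l, α, β, u, h⟩ := exists_map_eq (t, s)
  have ht : stdSimplex.map α u = t := congrArg Prod.fst h
  have hs : stdSimplex.map β u = s := congrArg Prod.snd h
  have e : stdSimplex.map (α ≫ f) u = stdSimplex.map f t := by
    rw [← ht, stdSimplex.map_comp_apply]
    rfl
  have h' := φ.glue_map x (α ≫ f) β u
  rw [op_comp, X.map_comp, ConcreteCategory.comp_apply, e, hs, ← glue_map, ht, hs] at h'
  exact h'.symm

theorem map_const {n : ℕ} (i : Fin 2) (t : stdSimplex ℝ (Fin (n + 1))) :
    stdSimplex.map (fun _ => i) t = stdSimplex.vertex i := by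
  ext j
  rw [stdSimplex.map_apply, stdSimplex.vertex_coe]
  by_cases h : i = j
  · simp [h]
  · simp [h, eq_comm]

theorem glue_vertex {n : SimplexCategory} (x : X.obj (op n)) (i : Fin 2)
    (t : stdSimplex ℝ (Fin (n.len + 1))) :
    φ.glue x (t, stdSimplex.vertex i) = φ.toFun n x (SimplexCategory.const n ⦋1⦌ i) t := by
  have h := φ.glue_map x (𝟙 n) (SimplexCategory.const n ⦋1⦌ i) t
  rw [op_id, X.map_id] at h
  refine Eq.trans ?_ h
  congr 2
  · exact (stdSimplex.map_id_apply t).symm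
  · exact (map_const i t).symm

/-- A compatible family on the simplices of `X × Δ^1` yields a homotopy between the maps
out of the realization of `X` given by its restrictions to the two ends. -/
theorem homotopic {g₀ g₁ : SSet.toTop.obj X ⟶ Z}
    (h₀ : ∀ (n : SimplexCategory) (x : X.obj (op n)) t,
      g₀ (charMap x t) = φ.toFun n x (SimplexCategory.const n ⦋1⦌ 0) t)
    (h₁ : ∀ (n : SimplexCategory) (x : X.obj (op n)) t,
      g₁ (charMap x t) = φ.toFun n x (SimplexCategory.const n ⦋1⦌ 1) t) :
    ContinuousMap.Homotopic g₀.hom g₁.hom := by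
  obtain ⟨g, hg⟩ := exists_desc (X := X) (Z := TopCat.of C(stdSimplex ℝ (Fin 2), Z))
    (fun n x => (φ.glue x).curry) fun f x t => ContinuousMap.ext fun s => φ.glue_naturality f x t s
  let ev (s : stdSimplex ℝ (Fin 2)) : TopCat.of C(stdSimplex ℝ (Fin 2), Z) ⟶ Z :=
    TopCat.ofHom ⟨fun γ => γ s, continuous_eval_const s⟩
  have e₀ : g ≫ ev (stdSimplex.vertex 0) = g₀ := toTop_hom_ext fun n x t => by
    rw [h₀, ← glue_vertex]
    exact congrArg (fun γ : C(stdSimplex ℝ (Fin 2), Z) => γ _) (hg n x t)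
  have e₁ : g ≫ ev (stdSimplex.vertex 1) = g₁ := toTop_hom_ext fun n x t => by
    rw [h₁, ← glue_vertex]
    exact congrArg (fun γ : C(stdSimplex ℝ (Fin 2), Z) => γ _) (hg n x t)
  let g' : C(SSet.toTop.obj X, C(stdSimplex ℝ (Fin 2), Z)) := g.hom
  have hg' : Continuous fun p : SSet.toTop.obj X × stdSimplex ℝ (Fin 2) => g' p.1 p.2 :=
    ContinuousMap.continuous_uncurry_of_continuous g'
  refine ⟨⟨⟨fun p => g' p.2 (stdSimplexHomeomorphUnitInterval.symm p.1), ?_⟩, fun x => ?_,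
    fun x => ?_⟩⟩
  · exact hg'.comp (continuous_snd.prodMk
      (stdSimplexHomeomorphUnitInterval.symm.continuous.comp continuous_fst))
  · rw [← e₀]
    change g' x (stdSimplexHomeomorphUnitInterval.symm 0) = _
    rw [← stdSimplexHomeomorphUnitInterval_zero, Homeomorph.symm_apply_apply]
    rfl
  · rw [← e₁]
    change g' x (stdSimplexHomeomorphUnitInterval.symm 1) = _
    rw [← stdSimplexHomeomorphUnitInterval_one, Homeomorph.symm_apply_apply]
    rfl

end CylinderFamily
end GeometricRealization

open GeometricRealization

section Nerve

variable {C D : Type (u + 1)} [Category.{u} C] [Category.{u} D]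

/-- The simplex of `nerve D` obtained from a simplex of `nerve C × Δ^1` and a natural
transformation. -/
def CategoryTheory.NatTrans.cylinderSimplex {F G : C ⥤ D} (α : F ⟶ G) {n : SimplexCategory}
    (x : (nerve C).obj (op n)) (β : n ⟶ ⦋1⦌) : (nerve D).obj (op n) :=
  Functor.prod' (β.toOrderHom.monotone.functor ⋙ ComposableArrows.mk₁ α) x ⋙
    Functor.uncurry.obj (𝟭 (C ⥤ D))

theorem CategoryTheory.NatTrans.cylinderSimplex_const_zero {F G : C ⥤ D} (α : F ⟶ G) {n : SimplexCategory}
    (x : (nerve C).obj (op n)) :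
    NatTrans.cylinderSimplex α x (SimplexCategory.const n ⦋1⦌ 0) = (nerveMap F).app (op n) x := by
  refine CategoryTheory.Functor.ext (fun _ => rfl) fun i j f => ?_
  change 𝟙 _ ≫ F.map _ = 𝟙 _ ≫ F.map _ ≫ 𝟙 _
  rw [Category.comp_id]
  rfl

theorem CategoryTheory.NatTrans.cylinderSimplex_const_one {F G : C ⥤ D} (α : F ⟶ G) {n : SimplexCategory}
    (x : (nerve C).obj (op n)) :
    NatTrans.cylinderSimplex α x (SimplexCategory.const n ⦋1⦌ 1) = (nerveMap G).app (op n) x := by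
  refine CategoryTheory.Functor.ext (fun _ => rfl) fun i j f => ?_
  change 𝟙 _ ≫ G.map _ = 𝟙 _ ≫ G.map _ ≫ 𝟙 _
  rw [Category.comp_id]
  rfl

/-- The family of simplices of `|nerve D|` associated with a natural transformation. -/
noncomputable def CategoryTheory.NatTrans.cylinderFamily {F G : C ⥤ D} (α : F ⟶ G) :
    CylinderFamily (nerve C) (SSet.toTop.obj (nerve D)) where
  toFun _ x β := charMap (NatTrans.cylinderSimplex α x β)
  naturality f x β t := charMap_map f (NatTrans.cylinderSimplex α x β) t

/-- A natural transformation induces a homotopy between the maps of classifying spaces. -/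
theorem classifyingMap_homotopic {F G : C ⥤ D} (α : F ⟶ G) :
    ContinuousMap.Homotopic (classifyingMap F) (classifyingMap G) := by
  refine (NatTrans.cylinderFamily α).homotopic (fun n x t => ?_) fun n x t => ?_
  · rw [toTop_map_charMap, ← NatTrans.cylinderSimplex_const_zero α]
    rfl
  · rw [toTop_map_charMap, ← NatTrans.cylinderSimplex_const_one α]
    rfl

theorem classifyingMap_id : classifyingMap (𝟭 C) = ContinuousMap.id _ := by
  have h : nerveMap (𝟭 C) = 𝟙 (nerve C) := rfl
  unfold classifyingMap
  rw [h, CategoryTheory.Functor.map_id]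
  rfl

theorem classifyingMap_comp {E : Type (u + 1)} [Category.{u} E] (F : C ⥤ D) (G : D ⥤ E) :
    classifyingMap (F ⋙ G) = (classifyingMap G).comp (classifyingMap F) := by
  have h : nerveMap (F ⋙ G) = nerveMap F ≫ nerveMap G := rfl
  unfold classifyingMap
  rw [h, CategoryTheory.Functor.map_comp]
  rfl

/-- An equivalence of categories induces a homotopy equivalence of classifying spaces. -/
noncomputable def classifyingHomotopyEquiv (e : C ≌ D) :
    classifyingSpace C ≃ₕ classifyingSpace D where
  toFun := classifyingMap e.functor
  invFun := classifyingMap e.inverse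
  left_inv := by
    rw [← classifyingMap_comp, ← classifyingMap_id]
    exact classifyingMap_homotopic e.unitIso.inv
  right_inv := by
    rw [← classifyingMap_comp, ← classifyingMap_id]
    exact classifyingMap_homotopic e.counitIso.hom

end Nerve

instance symInclusion_full (n : ℕ) : (symInclusion.{u} n).Full where
  map_surjective f := ⟨ULift.up (Equiv.ulift.permCongr f), Equiv.ext fun _ => rfl⟩

instance symInclusion_faithful (n : ℕ) : (symInclusion.{u} n).Faithful where
  map_injective {_ _ σ τ} h := by
    apply ULift.ext
    exact (Equiv.ulift.symm.permCongr).injective h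

instance symInclusion_essSurj (n : ℕ) : (symInclusion.{u} n).EssSurj where
  mem_essImage S := by
    have e : Fin n ≃ S.carrier := (finCongr S.card_eq.symm).trans (Finite.equivFin S.carrier).symm
    exact ⟨ULift.up (SingleObj.star _), ⟨{
      hom := Equiv.ulift.trans e
      inv := (Equiv.ulift.trans e).symm
      hom_inv_id := Equiv.self_trans_symm _
      inv_hom_id := Equiv.symm_trans_self _ }⟩⟩

instance symInclusion_isEquivalence (n : ℕ) : (symInclusion.{u} n).IsEquivalence where

namespace HalfEdgeGraph

/-- The disjoint union of the edges of a graph with those of the complete graph on its vertices. -/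
def addComplete (G : HalfEdgeGraph.{u}) : HalfEdgeGraph.{u} where
  V := G.V
  E := G.E ⊕ (complete G.V).E
  H := G.H ⊕ (complete G.V).H
  finiteE := inferInstance
  edge := Sum.map G.edge (complete G.V).edge
  edge_surjective := Sum.map_surjective.2 ⟨G.edge_surjective, (complete G.V).edge_surjective⟩
  tau := Sum.map G.tau (complete G.V).tau
  edge_tau := by
    rintro (h | h)
    · exact congrArg Sum.inl (G.edge_tau h)
    · exact congrArg Sum.inr ((complete G.V).edge_tau h)
  tau_ne := by
    rintro (h | h) e
    · exact G.tau_ne h (Sum.inl_injective e)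
    · exact (complete G.V).tau_ne h (Sum.inr_injective e)
  eq_or_eq_tau := by
    rintro (h | h) (k | k) e
    · exact (G.eq_or_eq_tau h k (Sum.inl_injective e)).imp (congrArg _) (congrArg _)
    · cases e
    · cases e
    · exact ((complete G.V).eq_or_eq_tau h k (Sum.inr_injective e)).imp (congrArg _) (congrArg _)
  bd := Sum.elim G.bd (complete G.V).bd

theorem addComplete_connected {G : HalfEdgeGraph.{u}} (h : G.Connected) :
    G.addComplete.Connected :=
  ⟨h.1, fun v w => Relation.ReflTransGen.mono
    (fun _ _ ⟨k, h₁, h₂⟩ => ⟨Sum.inl k, h₁, h₂⟩) v w (h.2 v w)⟩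

namespace Mono

variable {G G' G'' : HalfEdgeGraph.{u}}

theorem exists_toFun_inr (f : Mono G G') (h : G.H) : ∃ k, f.toFun (Sum.inr h) = Sum.inr k := by
  obtain ⟨k, hk⟩ := f.image_halfEdges ⟨_, ⟨h, rfl⟩, rfl⟩
  exact ⟨k, hk.symm⟩

/-- The map on half-edges underlying a monomorphism. -/
noncomputable def halfEdgeMap (f : Mono G G') (h : G.H) : G'.H :=
  (f.exists_toFun_inr h).choose

theorem toFun_inr (f : Mono G G') (h : G.H) :
    f.toFun (Sum.inr h) = Sum.inr (f.halfEdgeMap h) :=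
  (f.exists_toFun_inr h).choose_spec

theorem halfEdgeMap_injective (f : Mono G G') : Function.Injective f.halfEdgeMap := by
  intro h k e
  apply Sum.inr_injective
  apply f.injective
  rw [toFun_inr, toFun_inr, e]

theorem halfEdgeMap_tau (f : Mono G G') (h : G.H) :
    f.halfEdgeMap (G.tau h) = G'.tau (f.halfEdgeMap h) := by
  have e := f.map_tau (Sum.inr h)
  rw [toFun_inr] at e
  exact Sum.inr_injective ((f.toFun_inr (G.tau h)).symm.trans e)

theorem bd_halfEdgeMap (f : Mono G G') (h : G.H) :
    f.vertexMap (G.bd h) = G'.bd (f.halfEdgeMap h) := by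
  have e := f.map_bd (Sum.inr h)
  rw [toFun_inr] at e
  exact Sum.inl_injective ((f.toFun_inl (G.bd h)).symm.trans e)

/-- A monomorphism from a bijection of vertices and a compatible injection of half-edges. -/
def mk' (fV : G.V → G'.V) (fH : G.H → G'.H) (hV : Function.Bijective fV)
    (hH : Function.Injective fH) (htau : ∀ h, fH (G.tau h) = G'.tau (fH h))
    (hbd : ∀ h, fV (G.bd h) = G'.bd (fH h)) : Mono G G' where
  toFun := Sum.map fV fH
  map_tau := by
    rintro (v | h)
    · rfl
    · exact congrArg Sum.inr (htau h)
  map_bd := by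
    rintro (v | h)
    · rfl
    · exact congrArg Sum.inl (hbd h)
  injective := Sum.map_injective.2 ⟨hV.1, hH⟩
  image_vertices := by
    rw [← Set.range_comp]
    exact hV.2.range_comp Sum.inl
  image_halfEdges := by
    rw [← Set.range_comp]
    exact Set.range_comp_subset_range fH Sum.inr

/-- The map of half-edges of complete graphs induced by a monomorphism. -/
noncomputable def completeHalfEdgeMap (f : Mono G G') :
    (complete G.V).H → (complete G'.V).H :=
  fun p => ⟨(f.vertexMap p.1.1, f.vertexMap p.1.2),
    fun h => p.2 (f.vertexMap_bijective.1 h)⟩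

theorem completeHalfEdgeMap_injective (f : Mono G G') :
    Function.Injective f.completeHalfEdgeMap := by
  rintro ⟨⟨a, b⟩, h⟩ ⟨⟨c, d⟩, k⟩ e
  have e' := Prod.mk.inj (congrArg Subtype.val e)
  exact Subtype.ext (Prod.ext (f.vertexMap_bijective.1 e'.1) (f.vertexMap_bijective.1 e'.2))

/-- Functoriality of `addComplete`. -/
noncomputable def addCompleteMap (f : Mono G G') : Mono G.addComplete G'.addComplete :=
  mk' f.vertexMap (Sum.map f.halfEdgeMap f.completeHalfEdgeMap) f.vertexMap_bijective
    (Sum.map_injective.2 ⟨f.halfEdgeMap_injective, f.completeHalfEdgeMap_injective⟩)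
    (by
      rintro (h | h)
      · exact congrArg Sum.inl (f.halfEdgeMap_tau h)
      · rfl)
    (by
      rintro (h | h)
      · exact f.bd_halfEdgeMap h
      · rfl)

/-- The inclusion of a graph into `addComplete`. -/
def toAddComplete (G : HalfEdgeGraph.{u}) : Mono G G.addComplete :=
  mk' _root_.id Sum.inl Function.bijective_id Sum.inl_injective (fun _ => rfl) fun _ => rfl

/-- The inclusion of the complete graph into `addComplete`. -/
def completeToAddComplete (G : HalfEdgeGraph.{u}) : Mono (complete G.V) G.addComplete :=
  mk' _root_.id Sum.inr Function.bijective_id Sum.inr_injective (fun _ => rfl) fun _ => rfl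

theorem halfEdgeMap_id (h : G.H) : (Mono.id G).halfEdgeMap h = h :=
  (Sum.inr_injective ((Mono.id G).toFun_inr h)).symm

theorem halfEdgeMap_comp (f : Mono G G') (g : Mono G' G'') (h : G.H) :
    (f.comp g).halfEdgeMap h = g.halfEdgeMap (f.halfEdgeMap h) := by
  apply Sum.inr_injective
  rw [← toFun_inr, ← toFun_inr, ← toFun_inr]
  rfl

end Mono

end HalfEdgeGraph

open HalfEdgeGraph

/-- The endofunctor of `m𝒢(r)` adding the edges of the complete graph. -/
noncomputable def addCompleteFunctor (r : ℕ) : MGraph.{u} r ⥤ MGraph.{u} r where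
  obj G := ⟨G.graph.addComplete, addComplete_connected G.connected, G.card_vertices⟩
  map f := Mono.addCompleteMap f
  map_id G := Mono.ext <| funext <| by
    rintro (v | h | h)
    · rfl
    · exact congrArg (Sum.inr ∘ Sum.inl) (Mono.halfEdgeMap_id h)
    · rfl
  map_comp f g := Mono.ext <| funext <| by
    rintro (v | h | h)
    · exact congrArg Sum.inl (Mono.comp_vertexMap f g v)
    · exact congrArg (Sum.inr ∘ Sum.inl) (Mono.halfEdgeMap_comp f g h)
    · exact congrArg (Sum.inr ∘ Sum.inr) (Subtype.ext (Prod.ext (Mono.comp_vertexMap f g _)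
        (Mono.comp_vertexMap f g _)))

/-- The natural inclusion of a graph into its `addComplete`. -/
def toAddCompleteFunctor (r : ℕ) : 𝟭 (MGraph.{u} r) ⟶ addCompleteFunctor.{u} r where
  app G := Mono.toAddComplete G.graph
  naturality G G' f := Mono.ext <| funext <| by
    rintro (v | h)
    · exact congrArg _ (Mono.toFun_inl f v)
    · exact congrArg _ (Mono.toFun_inr f h)

/-- The natural inclusion of the complete graph on the vertices of a graph. -/
def completeToAddCompleteFunctor (r : ℕ) :
    vertexFunctor.{u} r ⋙ completeGraphFunctor.{u} r ⟶ addCompleteFunctor.{u} r where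
  app G := Mono.completeToAddComplete G.graph
  naturality G G' f := Mono.ext <| funext <| by
    rintro (v | h) <;> rfl

/-- The vertex set of the complete graph on a set is the set itself. -/
def completeVertexIso (r : ℕ) :
    completeGraphFunctor.{u} r ⋙ vertexFunctor.{u} r ⟶ 𝟭 (SetOfCard.{u} (r + 1)) where
  app S := Equiv.refl S.carrier
  naturality _ _ _ := Equiv.ext fun _ => rfl

theorem mainTheorem10 (r : ℕ) :
    (∃ h : classifyingSpace (MGraph.{u} r) ≃ₕ classifyingSpace (SetOfCard.{u} (r + 1)),
      h.toFun = classifyingMap (vertexFunctor.{u} r) ∧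
      h.invFun = classifyingMap (completeGraphFunctor.{u} r)) ∧
    (∃ h : classifyingSpace (SetOfCard.{u} (r + 1)) ≃ₕ
        classifyingSpace (OneObjectCategory.{u} (SymGroup.{u} (r + 1))),
      h.invFun = classifyingMap (symInclusion.{u} (r + 1))) := by
  refine ⟨⟨⟨classifyingMap (vertexFunctor.{u} r), classifyingMap (completeGraphFunctor.{u} r),
    ?_, ?_⟩, rfl, rfl⟩, ⟨(classifyingHomotopyEquiv (symInclusion.{u} (r + 1)).asEquivalence).symm,
    rfl⟩⟩
  · rw [← classifyingMap_comp, ← classifyingMap_id]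
    exact (classifyingMap_homotopic (completeToAddCompleteFunctor r)).trans
      (classifyingMap_homotopic (toAddCompleteFunctor r)).symm
  · rw [← classifyingMap_comp, ← classifyingMap_id]
    exact classifyingMap_homotopic (completeVertexIso r)
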